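/- Let $V:\mathbb R\to\mathbb R$ be smooth with $V(0)=V'(0)=0$ and $V''(0)>0$, let $\mu:\mathbb R\to\mathbb R$ be twice continuously differentiable, and consider Hamilton's equations $$\dot x=\frac{p}{\mu(x)},\qquad \dot p=\frac{\mu'(x)}{2\mu(x)^2}\,p^2-V'(x)$$ of the Hamiltonian $H(x,p)=\dfrac{p^2}{2\mu(x)}+V(x)$. Assume that for some $E^*>0$ and every $e\in(0,E^*)$ there is a closed orbit of energy $H=e$ surrounding the origin, and let $T(e)$ denote its minimal period. Let $0<E<E^*$, let $K(E)$ be the connected component containing $0$ of $\{x\in\mathbb R: V(x)\le E\}$, and assume $\mu(x)>0$ for all $x\in K(E)$. On $K(E)$ put $$N(x)=\left(\frac{V}{V'^2}\sqrt{\mu}\right)''(x)+\left(\frac{V}{V'^2}\,(\sqrt{\mu})'\right)'(x),$$ where $V/V'^2$ is extended to $x=0$ by its limit $1/(2V''(0))$. If $N(x)\ge 0$ for all $x\in K(E)$, then $T$ is increasing (that is, nondecreasing) on $(0,E)$. If $N(x)\le 0$ for all $x\in K(E)$, then $T$ is decreasing (that is, nonincreasing) on $(0,E)$. -/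

import Mathlib

open Set
open scoped ContDiff

noncomputable section

/-- The Hamiltonian `H(x, p) = p ^ 2 / (2 μ(x)) + V(x)` with position-dependent mass `μ`. -/
def hamiltonian (V μ : ℝ → ℝ) (z : ℝ × ℝ) : ℝ :=
  z.2 ^ 2 / (2 * μ z.1) + V z.1

/-- The Hamiltonian vector field
`x' = p / μ(x)`, `p' = μ'(x) / (2 μ(x) ^ 2) * p ^ 2 - V'(x)`. -/
def hamiltonianField (V μ : ℝ → ℝ) (z : ℝ × ℝ) : ℝ × ℝ :=
  (z.2 / μ z.1, deriv μ z.1 / (2 * μ z.1 ^ 2) * z.2 ^ 2 - deriv V z.1)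

/-- The set `Γ` in the plane surrounds the origin: the origin is not on `Γ` and lies in a bounded
connected component of the complement of `Γ`. -/
def SurroundsOrigin (Γ : Set (ℝ × ℝ)) : Prop :=
  (0 : ℝ × ℝ) ∉ Γ ∧ Bornology.IsBounded (connectedComponentIn Γᶜ (0 : ℝ × ℝ))

/-- `γ` is a solution of Hamilton's equations, defined for all times, that has energy `e`, is
periodic with period `τ > 0` (not necessarily the least one), and whose (closed) orbit surrounds
the origin. -/
structure IsClosedOrbit (V μ : ℝ → ℝ) (e τ : ℝ) (γ : ℝ → ℝ × ℝ) : Prop where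
  solution : ∀ t, HasDerivAt γ (hamiltonianField V μ (γ t)) t
  energy : ∀ t, hamiltonian V μ (γ t) = e
  period_pos : 0 < τ
  periodic : Function.Periodic γ τ
  surrounds : SurroundsOrigin (range γ)

/-- The origin is surrounded by closed orbits of all energies `e ∈ (0, Estar)`. -/
def HasCentre (V μ : ℝ → ℝ) (Estar : ℝ) : Prop :=
  ∀ e ∈ Ioo 0 Estar, ∃ τ γ, IsClosedOrbit V μ e τ γ

/-- The period function: the least time in which the closed orbit of energy `e` that surrounds
the origin is traversed. -/
def periodFunction (V μ : ℝ → ℝ) (e : ℝ) : ℝ :=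
  sInf {τ | ∃ γ, IsClosedOrbit V μ e τ γ}

/-- The potential well `K(E)` around the origin: the connected component of
`{x | V x ≤ E}` that contains `0`. -/
def potentialWell (V : ℝ → ℝ) (E : ℝ) : Set ℝ :=
  connectedComponentIn {x | V x ≤ E} 0

/-- The function `V / V' ^ 2`, with its removable singularity at the origin removed: if
`V(0) = V'(0) = 0` and `V''(0) ≠ 0`, the limit at `0` is `1 / (2 V''(0))`. -/
def chiconeQuotient (V : ℝ → ℝ) (x : ℝ) : ℝ :=
  if x = 0 then 1 / (2 * deriv (deriv V) 0) else V x / deriv V x ^ 2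

/-- `N = ((V / V' ^ 2) √μ)'' + ((V / V' ^ 2) (√μ)')'`. -/
def monotonicityFunction (V μ : ℝ → ℝ) (x : ℝ) : ℝ :=
  deriv (deriv fun y => chiconeQuotient V y * √(μ y)) x
    + deriv (fun y => chiconeQuotient V y * deriv (fun z => √(μ z)) y) x

end

/-! Write `q = V / V' ^ 2`. On the well a coordinate `s` with `x = X s`, `V (X s) = s ^ 2` makes the
potential quadratic, and differentiating this relation gives `X' = 2 √q`. On the level `e = c ^ 2`
put `s = c sin θ`, `p = √2 c √μ cos θ`. Hamilton's equations reduce to `θ' = √2 / F (c sin θ)` with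
`F = √μ(X) X' = 2 √q √μ`, whence `T(c ^ 2) = (1 / √2) ∫ F (c sin θ) dθ` over `[0, 2π]`.

The chain rule gives `F' = 2 (q' √μ + 2 q (√μ)')` at `X s`, and the `x`-derivative of the right side
is `2 N`. As `X` increases, `N ≥ 0` makes `F'` nondecreasing, so `F` is convex and its circular
means grow with the radius `c`. The case `N ≤ 0` is the same argument for `-F`; a factor `σ = ±1`
carries both.

Two further points need care. The well must have no critical point besides `0`; this comes from the
closed orbits, since at such a turning point an equilibrium would block the orbit
(`IsClosedOrbit.deriv_ne_zero_of_turning_point`). And every closed orbit of a given energy must be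
the explicit one up to a time shift, which is ODE uniqueness (`IsWell.exists_translate`,
`IsWell.periodFunction_eq`). -/

open Filter Topology

/-! ### Regularity of `V / V' ^ 2` at the minimum -/

/-- A continuous function whose derivative has a limit at a point is differentiable there. -/
theorem hasDerivAt_of_tendsto_deriv_nhdsNE {f g : ℝ → ℝ} {x l : ℝ}
    (hfg : ∀ᶠ y in 𝓝[≠] x, HasDerivAt f (g y) y) (hf : ContinuousAt f x)
    (hg : Tendsto g (𝓝[≠] x) (𝓝 l)) : HasDerivAt f l x := by
  rw [hasDerivAt_iff_tendsto_slope]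
  have h : Tendsto (fun y => (f y - f x) / (y - x)) (𝓝[≠] x) (𝓝 l) := by
    refine HasDerivAt.lhopital_zero_nhdsNE (f' := g) (g' := fun _ => 1) ?_ ?_ ?_ ?_ ?_ ?_
    · filter_upwards [hfg] with y hy using hy.sub_const _
    · exact Eventually.of_forall fun y => (hasDerivAt_id y).sub_const x
    · simp
    · have := hf.tendsto.sub_const (f x)
      rw [sub_self] at this
      exact this.mono_left nhdsWithin_le_nhds
    · have := (continuous_id.tendsto x).sub_const x
      simp only [id, sub_self] at this
      exact this.mono_left nhdsWithin_le_nhds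
    · simpa using hg
  refine h.congr fun y => ?_
  rw [slope_def_field]

theorem ContDiff.hasDerivAt_deriv_deriv {V : ℝ → ℝ} (hV : ContDiff ℝ ∞ V) (x : ℝ) :
    HasDerivAt (deriv V) (deriv (deriv V) x) x :=
  ((contDiff_infty_iff_deriv.1 hV).2.differentiable (by simp) x).hasDerivAt

theorem ContDiff.continuous_deriv_deriv {V : ℝ → ℝ} (hV : ContDiff ℝ ∞ V) :
    Continuous (deriv (deriv V)) :=
  (contDiff_infty_iff_deriv.1 (contDiff_infty_iff_deriv.1 hV).2).2.continuous

theorem differentiableAt_deriv_of_contDiffAt_two {f : ℝ → ℝ} {x : ℝ} (hf : ContDiffAt ℝ 2 f x) :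
    DifferentiableAt ℝ (deriv f) x :=
  (hf.derivWithin (m := 1) (by norm_num [one_add_one_eq_two])).differentiableAt one_ne_zero

section Critical

variable {V : ℝ → ℝ}

theorem eventually_deriv_ne_zero (hV : ContDiff ℝ ∞ V) (hV2 : 0 < deriv (deriv V) 0) :
    ∀ᶠ x in 𝓝[≠] (0 : ℝ), deriv V x ≠ 0 := by
  have h := (hV.hasDerivAt_deriv_deriv 0).eventually_ne (c := 0) hV2.ne'
  simpa using h

theorem tendsto_div_deriv_sq (hV : ContDiff ℝ ∞ V) (hV0 : V 0 = 0) (hV1 : deriv V 0 = 0)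
    (hV2 : 0 < deriv (deriv V) 0) :
    Tendsto (fun x => V x / deriv V x ^ 2) (𝓝[≠] 0) (𝓝 (1 / (2 * deriv (deriv V) 0))) := by
  have hne := eventually_deriv_ne_zero hV hV2
  have hV2' : ∀ᶠ x in 𝓝[≠] (0 : ℝ), deriv (deriv V) x ≠ 0 :=
    (hV.continuous_deriv_deriv.continuousAt.eventually_ne hV2.ne').filter_mono nhdsWithin_le_nhds
  have hd : Continuous (deriv V) := (contDiff_infty_iff_deriv.1 hV).2.continuous
  refine HasDerivAt.lhopital_zero_nhdsNE (f' := deriv V)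
    (g' := fun x => 2 * deriv V x * deriv (deriv V) x) ?_ ?_ ?_ ?_ ?_ ?_
  · exact Eventually.of_forall fun x => (hV.differentiable (by simp) x).hasDerivAt
  · refine Eventually.of_forall fun x => ?_
    refine ((hV.hasDerivAt_deriv_deriv x).fun_pow 2).congr_deriv ?_
    simp
  · filter_upwards [hne, hV2'] with x h1 h2 using by positivity
  · exact (hV.continuous.tendsto' 0 0 hV0).mono_left nhdsWithin_le_nhds
  · exact ((hd.pow 2).tendsto' 0 0 (by simp [hV1])).mono_left nhdsWithin_le_nhds
  · have h : Tendsto (fun x => 1 / (2 * deriv (deriv V) x)) (𝓝[≠] 0)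
        (𝓝 (1 / (2 * deriv (deriv V) 0))) := by
      refine (ContinuousAt.tendsto ?_).mono_left nhdsWithin_le_nhds
      have := hV.continuous_deriv_deriv.continuousAt (x := 0)
      fun_prop (disch := positivity)
    refine h.congr' ?_
    filter_upwards [hne, hV2'] with x h1 h2
    field_simp

theorem eventually_pos_of_deriv2_pos (hV : ContDiff ℝ ∞ V) (hV0 : V 0 = 0) (hV1 : deriv V 0 = 0)
    (hV2 : 0 < deriv (deriv V) 0) : ∀ᶠ x in 𝓝[≠] (0 : ℝ), 0 < V x := by
  have h := (tendsto_div_deriv_sq hV hV0 hV1 hV2).eventually_const_lt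
    (u := 0) (by positivity)
  filter_upwards [h, eventually_deriv_ne_zero hV hV2] with x h1 h2
  exact (div_pos_iff_of_pos_right (by positivity)).1 h1

theorem eventuallyEq_chiconeQuotient {x : ℝ} (hx : x ≠ 0) :
    chiconeQuotient V =ᶠ[𝓝 x] fun y => V y / deriv V y ^ 2 := by
  filter_upwards [isOpen_ne.mem_nhds hx] with y hy
  exact if_neg hy

theorem continuousAt_chiconeQuotient_zero (hV : ContDiff ℝ ∞ V) (hV0 : V 0 = 0)
    (hV1 : deriv V 0 = 0) (hV2 : 0 < deriv (deriv V) 0) :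
    ContinuousAt (chiconeQuotient V) 0 := by
  rw [continuousAt_iff_punctured_nhds]
  have : chiconeQuotient V 0 = 1 / (2 * deriv (deriv V) 0) := if_pos rfl
  rw [this]
  refine (tendsto_div_deriv_sq hV hV0 hV1 hV2).congr' ?_
  filter_upwards [self_mem_nhdsWithin] with y hy
  exact (if_neg hy).symm

theorem contDiffAt_chiconeQuotient (hV : ContDiff ℝ ∞ V) {x : ℝ} (hx : x ≠ 0)
    (hx' : deriv V x ≠ 0) : ContDiffAt ℝ 2 (chiconeQuotient V) x := by
  refine ContDiffAt.congr_of_eventuallyEq ?_ (eventuallyEq_chiconeQuotient hx)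
  have h1 : ContDiffAt ℝ 2 V x := (contDiff_infty.1 hV 2).contDiffAt
  have h2 : ContDiffAt ℝ 2 (deriv V) x :=
    (contDiff_infty.1 (contDiff_infty_iff_deriv.1 hV).2 2).contDiffAt
  exact h1.div (h2.pow 2) (by positivity)

theorem hasDerivAt_chiconeQuotient (hV : ContDiff ℝ ∞ V) {x : ℝ} (hx : x ≠ 0)
    (hx' : deriv V x ≠ 0) :
    HasDerivAt (chiconeQuotient V)
      ((deriv V x ^ 2 - 2 * V x * deriv (deriv V) x) / deriv V x ^ 3) x := by
  refine HasDerivAt.congr_of_eventuallyEq ?_ (eventuallyEq_chiconeQuotient hx)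
  have h1 := (hV.differentiable (by simp) x).hasDerivAt
  refine (h1.div ((hV.hasDerivAt_deriv_deriv x).fun_pow 2) (pow_ne_zero 2 hx')).congr_deriv ?_
  field_simp
  simp
  ring

/-- The derivative of `V / V' ^ 2` has a limit at a nondegenerate minimum. -/
theorem tendsto_deriv_chiconeQuotient (hV : ContDiff ℝ ∞ V) (hV0 : V 0 = 0)
    (hV1 : deriv V 0 = 0) (hV2 : 0 < deriv (deriv V) 0) :
    ∃ l, Tendsto (fun x => (deriv V x ^ 2 - 2 * V x * deriv (deriv V) x) / deriv V x ^ 3)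
      (𝓝[≠] 0) (𝓝 l) := by
  have hne := eventually_deriv_ne_zero hV hV2
  have hV2' : ∀ᶠ x in 𝓝[≠] (0 : ℝ), deriv (deriv V) x ≠ 0 :=
    (hV.continuous_deriv_deriv.continuousAt.eventually_ne hV2.ne').filter_mono nhdsWithin_le_nhds
  have hd := (contDiff_infty_iff_deriv.1 hV).2
  have hd2 := hV.continuous_deriv_deriv
  have hd3 : Continuous (deriv (deriv (deriv V))) := hd.continuous_deriv_deriv
  -- In l'Hôpital's rule the terms `2 V' V''` cancel, leaving `-2 V V''' / (3 V' ^ 2 V'')`, which is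
  -- `-2/3` times `V / V' ^ 2` times `V''' / V''`.
  refine ⟨-(2 / 3) * (1 / (2 * deriv (deriv V) 0)) *
    (deriv (deriv (deriv V)) 0 / deriv (deriv V) 0), ?_⟩
  refine HasDerivAt.lhopital_zero_nhdsNE (f' := fun x => -2 * V x * deriv (deriv (deriv V)) x)
    (g' := fun x => 3 * deriv V x ^ 2 * deriv (deriv V) x) ?_ ?_ ?_ ?_ ?_ ?_
  · refine Eventually.of_forall fun x => ?_
    have h1 := (hV.differentiable (by simp) x).hasDerivAt
    refine (((hV.hasDerivAt_deriv_deriv x).fun_pow 2).sub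
      ((h1.const_mul 2).mul (hd.hasDerivAt_deriv_deriv x))).congr_deriv ?_
    simp only [Nat.cast_ofNat]
    ring
  · refine Eventually.of_forall fun x => ?_
    refine ((hV.hasDerivAt_deriv_deriv x).fun_pow 3).congr_deriv ?_
    simp
  · filter_upwards [hne, hV2'] with x h1 h2 using by positivity
  · refine (Continuous.tendsto' ?_ 0 0 (by simp [hV0, hV1])).mono_left nhdsWithin_le_nhds
    have := hV.continuous
    have := hd.continuous
    fun_prop
  · exact ((hd.continuous.pow 3).tendsto' 0 0 (by simp [hV1])).mono_left nhdsWithin_le_nhds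
  · have h3 : Tendsto (fun x => deriv (deriv (deriv V)) x / deriv (deriv V) x) (𝓝[≠] 0)
        (𝓝 (deriv (deriv (deriv V)) 0 / deriv (deriv V) 0)) :=
      (ContinuousAt.tendsto (hd3.continuousAt.div hd2.continuousAt hV2.ne')).mono_left
        nhdsWithin_le_nhds
    refine (((tendsto_div_deriv_sq hV hV0 hV1 hV2).const_mul (-(2 / 3))).mul h3).congr' ?_
    filter_upwards [hne, hV2'] with x h1 h2
    field_simp

theorem differentiableAt_chiconeQuotient_zero (hV : ContDiff ℝ ∞ V) (hV0 : V 0 = 0)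
    (hV1 : deriv V 0 = 0) (hV2 : 0 < deriv (deriv V) 0) :
    DifferentiableAt ℝ (chiconeQuotient V) 0 ∧ ContinuousAt (deriv (chiconeQuotient V)) 0 := by
  obtain ⟨l, hl⟩ := tendsto_deriv_chiconeQuotient hV hV0 hV1 hV2
  have h : ∀ᶠ x in 𝓝[≠] (0 : ℝ), HasDerivAt (chiconeQuotient V)
      ((deriv V x ^ 2 - 2 * V x * deriv (deriv V) x) / deriv V x ^ 3) x := by
    filter_upwards [eventually_deriv_ne_zero hV hV2, self_mem_nhdsWithin] with x h1 h2
    exact hasDerivAt_chiconeQuotient hV h2 h1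
  have hl' := hasDerivAt_of_tendsto_deriv_nhdsNE h
    (continuousAt_chiconeQuotient_zero hV hV0 hV1 hV2) hl
  refine ⟨hl'.differentiableAt, ?_⟩
  rw [continuousAt_iff_punctured_nhds, hl'.deriv]
  exact hl.congr' (h.mono fun x hx => hx.deriv.symm)

end Critical

/-! ### Closed orbits, uniqueness of solutions and turning points -/

/-- A ray from the origin that missed `Γ` would be an unbounded connected subset of the bounded
component of the origin. -/
theorem SurroundsOrigin.exists_smul_mem {Γ : Set (ℝ × ℝ)} (h : SurroundsOrigin Γ) {v : ℝ × ℝ}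
    (hv : v ≠ 0) : ∃ r : ℝ, 0 < r ∧ r • v ∈ Γ := by
  by_contra! hc
  have hsub : (fun r : ℝ => r • v) '' Ici 0 ⊆ connectedComponentIn Γᶜ (0 : ℝ × ℝ) := by
    refine IsPreconnected.subset_connectedComponentIn ?_ ⟨0, by simp, by simp⟩ ?_
    · exact isPreconnected_Ici.image _ (by fun_prop)
    · rintro _ ⟨r, hr, rfl⟩
      rcases (mem_Ici.1 hr).eq_or_lt with rfl | hr
      · simpa using h.1
      · exact hc r hr
  obtain ⟨C, hC⟩ := (h.2.subset hsub).exists_norm_le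
  have hv' : 0 < ‖v‖ := norm_pos_iff.2 hv
  have := hC _ ⟨(|C| + 1) / ‖v‖, by simp; positivity, rfl⟩
  rw [norm_smul, Real.norm_of_nonneg (by positivity), div_mul_cancel₀ _ hv'.ne'] at this
  linarith [le_abs_self C]

theorem contDiffAt_hamiltonianField {V μ : ℝ → ℝ} (hV : ContDiff ℝ ∞ V) (hμ : ContDiff ℝ 2 μ)
    {z : ℝ × ℝ} (hz : μ z.1 ≠ 0) : ContDiffAt ℝ 1 (hamiltonianField V μ) z := by
  have h1 : ContDiff ℝ 1 fun z : ℝ × ℝ => μ z.1 :=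
    (hμ.of_le one_le_two).comp contDiff_fst
  have h2 : ContDiff ℝ 1 fun z : ℝ × ℝ => deriv μ z.1 :=
    ContDiff.comp (hμ.deriv' (n := 1)) contDiff_fst
  have h3 : ContDiff ℝ 1 fun z : ℝ × ℝ => deriv V z.1 :=
    ContDiff.comp (contDiff_infty.1 (contDiff_infty_iff_deriv.1 hV).2 1) contDiff_fst
  have h4 : ContDiff ℝ 1 fun z : ℝ × ℝ => z.2 := contDiff_snd
  refine ContDiffAt.prodMk (h4.contDiffAt.div h1.contDiffAt hz) ?_
  refine ContDiffAt.sub (ContDiffAt.mul (h2.contDiffAt.div ?_ (by positivity)) ?_) h3.contDiffAt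
  · exact contDiffAt_const.mul (h1.contDiffAt.pow 2)
  · exact h4.contDiffAt.pow 2

/-- Two solutions of Hamilton's equations that meet once coincide, provided the mass does not
vanish along one of them. -/
theorem eq_of_hasDerivAt_hamiltonianField {V μ : ℝ → ℝ} (hV : ContDiff ℝ ∞ V)
    (hμ : ContDiff ℝ 2 μ) {f g : ℝ → ℝ × ℝ}
    (hf : ∀ t, HasDerivAt f (hamiltonianField V μ (f t)) t)
    (hg : ∀ t, HasDerivAt g (hamiltonianField V μ (g t)) t)
    (hμf : ∀ t, μ (f t).1 ≠ 0) {t₀ : ℝ} (h0 : f t₀ = g t₀) : f = g := by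
  have hfc : Continuous f := continuous_iff_continuousAt.2 fun t => (hf t).continuousAt
  have hgc : Continuous g := continuous_iff_continuousAt.2 fun t => (hg t).continuousAt
  have hclopen : IsClopen {t | f t = g t} := by
    refine ⟨isClosed_eq hfc hgc, isOpen_iff_mem_nhds.2 fun t ht => ?_⟩
    -- Where the mass is nonzero the field is `C^1`, hence locally Lipschitz, and local uniqueness
    -- makes the set of agreement open.
    obtain ⟨K, s, hs, hK⟩ := (contDiffAt_hamiltonianField hV hμ (hμf t)).exists_lipschitzOnWith
    refine ODE_solution_unique_of_eventually (v := fun _ => hamiltonianField V μ)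
      (s := fun _ => s) (K := K) (Eventually.of_forall fun _ => hK) ?_ ?_ ht
    · filter_upwards [hfc.continuousAt hs] with u hu using ⟨hf u, hu⟩
    · have ht' : f t = g t := ht
      rw [ht'] at hs
      filter_upwards [hgc.continuousAt hs] with u hu using ⟨hg u, hu⟩
  have := hclopen.eq_univ ⟨t₀, h0⟩
  exact funext fun t => (this ▸ mem_univ t : t ∈ {t | f t = g t})

theorem hasDerivAt_const_hamiltonianField {V μ : ℝ → ℝ} {c : ℝ} (hc : deriv V c = 0) (t : ℝ) :
    HasDerivAt (fun _ : ℝ => ((c, 0) : ℝ × ℝ)) (hamiltonianField V μ (c, 0)) t := by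
  have : hamiltonianField V μ (c, 0) = 0 := by simp [hamiltonianField, hc]
  rw [this]
  exact hasDerivAt_const _ _

namespace IsClosedOrbit

variable {V μ : ℝ → ℝ} {e τ : ℝ} {γ : ℝ → ℝ × ℝ}

theorem continuous (h : IsClosedOrbit V μ e τ γ) : Continuous γ :=
  continuous_iff_continuousAt.2 fun t => (h.solution t).continuousAt

theorem exists_potential_eq (h : IsClosedOrbit V μ e τ γ) {v : ℝ} (hv : v ≠ 0) :
    ∃ r : ℝ, 0 < r ∧ V (r * v) = e := by
  obtain ⟨r, hr, t, ht⟩ := h.surrounds.exists_smul_mem (v := (v, 0)) (by simpa using hv)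
  refine ⟨r, hr, ?_⟩
  have := h.energy t
  simpa [ht, hamiltonian] using this

theorem exists_fst_eq_zero (h : IsClosedOrbit V μ e τ γ) : ∃ t, (γ t).1 = 0 := by
  obtain ⟨r, hr, t, ht⟩ := h.surrounds.exists_smul_mem (v := (0, 1)) (by simp)
  exact ⟨t, by simp [ht]⟩

/-- A turning point of a closed orbit is not a critical point of the potential. -/
theorem deriv_ne_zero_of_turning_point (h : IsClosedOrbit V μ e τ γ) (hV : ContDiff ℝ ∞ V)
    (hμ : ContDiff ℝ 2 μ) {c : ℝ} (hc : c ≠ 0) (hVc : V c = e)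
    (hlt : ∀ y ∈ uIcc 0 c, y ≠ c → V y < e) (hpos : ∀ y ∈ uIcc 0 c, 0 < μ y) :
    deriv V c ≠ 0 := by
  intro hd
  have hcont : Continuous fun t => (γ t).1 := continuous_fst.comp h.continuous
  obtain ⟨t₀, ht₀⟩ := h.exists_fst_eq_zero
  -- Conservation of energy forces `p = 0` at `x = c`, so the orbit would meet the equilibrium `(c,
  -- 0)` and be constant, yet it passes over `x = 0`.
  have hne : ∀ t, (γ t).1 ≠ c := by
    intro t ht
    have hμc : 0 < μ c := hpos c right_mem_uIcc
    have hen := h.energy t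
    rw [hamiltonian, ht, hVc, add_eq_right, div_eq_zero_iff] at hen
    have hp : (γ t).2 = 0 := by
      rcases hen with hen | hen
      · exact pow_eq_zero_iff two_ne_zero |>.1 hen
      · linarith
    have := eq_of_hasDerivAt_hamiltonianField hV hμ
      (f := fun _ => (c, 0)) (g := γ) (hasDerivAt_const_hamiltonianField hd) h.solution
      (fun _ => hμc.ne') (t₀ := t) (Prod.ext ht.symm hp.symm)
    rw [← this] at ht₀
    exact hc ht₀
  -- Between `0` and `c` there is kinetic energy left, so `x` cannot be stationary. But its range is
  -- a compact interval containing `0` and missing `c`, so the extreme value on the side of `c` lies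
  -- there.
  have hmem : ∀ t, (γ t).1 ∈ uIcc 0 c → deriv (fun t => (γ t).1) t ≠ 0 := by
    intro t ht
    have hx : HasDerivAt (fun t => (γ t).1) ((γ t).2 / μ (γ t).1) t := (h.solution t).fst
    rw [hx.deriv]
    refine div_ne_zero (fun hp => ?_) (hpos _ ht).ne'
    have hen := h.energy t
    have := hlt _ ht (hne t)
    simp [hamiltonian, hp] at hen
    linarith
  have hper : Function.Periodic (fun t => (γ t).1) τ := fun t => by simp [h.periodic t]
  have hcomp : IsCompact (range fun t => (γ t).1) := 
    hper.compact_of_continuous h.period_pos.ne' hcont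
  have hconn : OrdConnected (range fun t => (γ t).1) :=
    (isPreconnected_range hcont).ordConnected
  have h0 : (0 : ℝ) ∈ range fun t => (γ t).1 := ⟨t₀, ht₀⟩
  have hcn : c ∉ range fun t => (γ t).1 := fun ⟨t, ht⟩ => hne t ht
  rcases hc.lt_or_gt with hneg | hpos'
  · obtain ⟨m, ⟨t, rfl⟩, hm⟩ := hcomp.exists_isLeast ⟨0, h0⟩
    have hcm : c < (γ t).1 := lt_of_not_ge fun hle => hcn (hconn.out ⟨t, rfl⟩ h0 ⟨hle, hneg.le⟩)
    refine hmem t ?_ (IsLocalMin.deriv_eq_zero (Eventually.of_forall fun u => hm ⟨u, rfl⟩))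
    rw [uIcc_of_ge hneg.le]
    exact ⟨hcm.le, hm h0⟩
  · obtain ⟨m, ⟨t, rfl⟩, hm⟩ := hcomp.exists_isGreatest ⟨0, h0⟩
    have hcm : (γ t).1 < c := lt_of_not_ge fun hle => hcn (hconn.out h0 ⟨t, rfl⟩ ⟨hpos'.le, hle⟩)
    refine hmem t ?_ (IsLocalMax.deriv_eq_zero (Eventually.of_forall fun u => hm ⟨u, rfl⟩))
    rw [uIcc_of_le hpos'.le]
    exact ⟨hm h0, hcm.le⟩

end IsClosedOrbit

/-! ### The shape of the potential well -/

theorem deriv_nonneg_of_le_left {f : ℝ → ℝ} {a x : ℝ} (hf : DifferentiableAt ℝ f x) (hax : a < x)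
    (h : ∀ y ∈ Ico a x, f y ≤ f x) : 0 ≤ deriv f x := by
  have hs := (hasDerivWithinAt_iff_tendsto_slope' (s := Iio x) (by simp)).1
    hf.hasDerivAt.hasDerivWithinAt
  refine ge_of_tendsto hs ?_
  filter_upwards [Ioo_mem_nhdsLT hax] with y hy
  rw [slope_def_field]
  exact div_nonneg_of_nonpos (by linarith [h y ⟨hy.1.le, hy.2⟩]) (by linarith [hy.2])

/-- If a function positive to the right of its zero `0` is regular at every point where it
exceeds all its earlier values, then it has positive derivative up to any such point. -/
theorem deriv_pos_of_record_regular {f : ℝ → ℝ} (hf : Differentiable ℝ f) (h0 : f 0 = 0)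
    (hpos : ∀ᶠ x in 𝓝[>] (0 : ℝ), 0 < f x) {b : ℝ}
    (hreg : ∀ c ∈ Ioc 0 b, 0 < f c → (∀ y ∈ Ico 0 c, f y < f c) → deriv f c ≠ 0) :
    ∀ x ∈ Ioc 0 b, 0 < deriv f x := by
  have key : ∀ x ∈ Ioc 0 b, ∀ y ∈ Ico 0 x, f y < f x := by
    intro x hx y hy
    by_contra! hle
    obtain ⟨m, hm, hmax⟩ := isCompact_Icc.exists_isMaxOn (nonempty_Icc.2 hx.1.le)
      hf.continuous.continuousOn
    -- The first maximiser `c` on `[0, x]` exceeds all earlier values, and if `f y ≥ f x` with `y <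
    -- x` it is interior, so `f' c = 0` against regularity.
    have hcomp : IsCompact {z ∈ Icc 0 x | f z = f m} :=
      isCompact_Icc.inter_right (isClosed_eq hf.continuous continuous_const)
    obtain ⟨c, ⟨hc, hcm⟩, hleast⟩ := hcomp.exists_isLeast ⟨m, hm, rfl⟩
    have hmax' : ∀ z ∈ Icc 0 x, f z ≤ f c := fun z hz => hcm ▸ hmax hz
    have hcx : c < x := by
      refine lt_of_le_of_ne hc.2 fun hcx => ?_
      have hym : f y = f m := by
        refine le_antisymm (hmax ⟨hy.1, hy.2.le⟩) ?_
        rw [← hcm, hcx]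
        exact hle
      have := hleast ⟨⟨hy.1, hy.2.le⟩, hym⟩
      linarith [hy.2]
    obtain ⟨z, hz, hz'⟩ := (hpos.and (Ioo_mem_nhdsGT hx.1)).exists
    have hfc : 0 < f c := hz.trans_le (hmax' z ⟨hz'.1.le, hz'.2.le⟩)
    have hc0 : 0 < c := lt_of_le_of_ne hc.1 fun h => by rw [← h, h0] at hfc; exact hfc.false
    refine hreg c ⟨hc0, hcx.le.trans hx.2⟩ hfc (fun w hw => ?_) ?_
    · refine lt_of_le_of_ne (hmax' w ⟨hw.1, hw.2.le.trans hc.2⟩) fun hwc => ?_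
      have := hleast ⟨⟨hw.1, hw.2.le.trans hc.2⟩, hwc.trans hcm⟩
      linarith [hw.2]
    · refine IsLocalMax.deriv_eq_zero ?_
      filter_upwards [Ioo_mem_nhds hc0 hcx] with w hw using hmax' w ⟨hw.1.le, hw.2.le⟩
  intro x hx
  refine lt_of_le_of_ne
    (deriv_nonneg_of_le_left (hf x) hx.1 fun y hy => (key x hx y hy).le) (Ne.symm ?_)
  refine hreg x hx ?_ (key x hx)
  simpa [h0] using key x hx 0 ⟨le_rfl, hx.1⟩

theorem exists_first_hit {f : ℝ → ℝ} (hf : Continuous f) {c E : ℝ} (hc : 0 < c) (h0 : f 0 < E)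
    (hfc : f c = E) : ∃ b, 0 < b ∧ f b = E ∧ ∀ x ∈ Ico 0 b, f x < E := by
  have hcomp : IsCompact {z ∈ Icc 0 c | f z = E} :=
    isCompact_Icc.inter_right (isClosed_eq hf continuous_const)
  obtain ⟨b, ⟨hb, hbE⟩, hleast⟩ := hcomp.exists_isLeast ⟨c, ⟨hc.le, le_rfl⟩, hfc⟩
  refine ⟨b, lt_of_le_of_ne hb.1 fun h => ?_, hbE, fun x hx => ?_⟩
  · rw [← h] at hbE
    linarith
  · by_contra! hle
    obtain ⟨y, hy, hyE⟩ := intermediate_value_Icc hx.1 hf.continuousOn ⟨h0.le, hle⟩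
    have := hleast ⟨⟨hy.1, hy.2.trans (hx.2.le.trans hb.2)⟩, hyE⟩
    linarith [hy.2, hx.2]

/-- `[a, b]` is a potential well of depth `E` with its bottom at the nondegenerate minimum `0`, on
which the mass is positive. -/
structure IsWell (V μ : ℝ → ℝ) (a b E : ℝ) : Prop where
  smooth : ContDiff ℝ ∞ V
  mass : ContDiff ℝ 2 μ
  zero : V 0 = 0
  deriv_zero : deriv V 0 = 0
  deriv2_pos : 0 < deriv (deriv V) 0
  left : a < 0
  right : 0 < b
  left_eq : V a = E
  right_eq : V b = E
  deriv_pos : ∀ x ∈ Ioc 0 b, 0 < deriv V x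
  deriv_neg : ∀ x ∈ Ico a 0, deriv V x < 0
  mass_pos : ∀ x ∈ Icc a b, 0 < μ x

/-- The endpoints are the first points on either side where `V` reaches `E`; they exist because the
orbit of energy `E` crosses both half-axes `p = 0`. A point `c` where `V` exceeds its values closer
to `0` is a turning point for the energy `V c`, hence noncritical. The left side is treated by the
reflection `x ↦ -x`. -/
theorem exists_isWell {V μ : ℝ → ℝ} (hV : ContDiff ℝ ∞ V) (hμ : ContDiff ℝ 2 μ)
    (hV0 : V 0 = 0) (hV1 : deriv V 0 = 0) (hV2 : 0 < deriv (deriv V) 0)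
    {Estar : ℝ} (hcentre : HasCentre V μ Estar)
    {E : ℝ} (hE : E ∈ Ioo 0 Estar) (hμpos : ∀ x ∈ potentialWell V E, 0 < μ x) :
    ∃ a b, Icc a b ⊆ potentialWell V E ∧ IsWell V μ a b E := by
  obtain ⟨τ, γ, hγ⟩ := hcentre E hE
  obtain ⟨r, hr, hrE⟩ := hγ.exists_potential_eq one_ne_zero
  obtain ⟨l, hl, hlE⟩ := hγ.exists_potential_eq (v := -1) (by norm_num)
  obtain ⟨b, hb, hbE, hblt⟩ := exists_first_hit hV.continuous (c := r) hr (by rw [hV0]; exact hE.1)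
    (by simpa using hrE)
  obtain ⟨a', ha, haE, halt⟩ := exists_first_hit (f := fun x => V (-x))
    (hV.continuous.comp continuous_neg) (c := l) hl (by simpa [hV0] using hE.1) (by simpa using hlE)
  have hsub : Icc (-a') b ⊆ potentialWell V E := by
    refine isPreconnected_Icc.subset_connectedComponentIn ⟨by linarith, hb.le⟩ fun x hx => ?_
    rcases le_total 0 x with h | h
    · rcases hx.2.eq_or_lt with rfl | h'
      · exact hbE.le
      · exact (hblt x ⟨h, h'⟩).le
    · rcases hx.1.eq_or_lt with rfl | h'
      · exact haE.le
      · have := (halt (-x) ⟨by linarith, by linarith⟩).le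
        simpa using this
  have hev := eventually_pos_of_deriv2_pos hV hV0 hV1 hV2
  have hle : ∀ x ∈ Icc (-a') b, V x ≤ E := fun x hx =>
    connectedComponentIn_subset {x | V x ≤ E} 0 (hsub hx)
  refine ⟨-a', b, hsub, hV, hμ, hV0, hV1, hV2, by linarith, hb, haE, hbE, ?_, ?_,
    fun x hx => hμpos x (hsub hx)⟩
  · refine deriv_pos_of_record_regular (hV.differentiable (by simp)) hV0
      (hev.filter_mono (nhdsWithin_mono _ fun x hx => (mem_Ioi.1 hx).ne')) fun c hc hc0 hrec => ?_
    obtain ⟨τ, γ, hγ⟩ := hcentre (V c)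
      ⟨hc0, (hle c ⟨by linarith [hc.1], hc.2⟩).trans_lt hE.2⟩
    refine hγ.deriv_ne_zero_of_turning_point hV hμ hc.1.ne' rfl ?_ ?_
    · rw [uIcc_of_le hc.1.le]
      exact fun y hy hne => hrec y ⟨hy.1, lt_of_le_of_ne hy.2 hne⟩
    · rw [uIcc_of_le hc.1.le]
      exact fun y hy => hμpos y (hsub ⟨by linarith [hy.1], hy.2.trans hc.2⟩)
  · intro x hx
    have key := deriv_pos_of_record_regular (f := fun x => V (-x)) (b := a')
      ((hV.differentiable (by simp)).comp differentiable_neg) (by simpa using hV0) ?_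
      (fun c hc hc0 hrec => ?_) (-x) ⟨by linarith [hx.2], by linarith [hx.1]⟩
    · rw [deriv_comp_neg] at key
      simpa using key
    · have ht : Tendsto (fun x : ℝ => -x) (𝓝[>] 0) (𝓝[≠] 0) := by
        refine tendsto_nhdsWithin_of_tendsto_nhds_of_eventually_within _ ?_ ?_
        · exact (continuous_neg.tendsto' 0 0 neg_zero).mono_left nhdsWithin_le_nhds
        · filter_upwards [self_mem_nhdsWithin] with y hy
          simpa using (mem_Ioi.1 hy).ne'
      exact ht.eventually hev
    · obtain ⟨τ, γ, hγ⟩ := hcentre (V (-c))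
        ⟨hc0, (hle (-c) ⟨by linarith [hc.2], by linarith [hc.1]⟩).trans_lt hE.2⟩
      rw [deriv_comp_neg, neg_ne_zero]
      refine hγ.deriv_ne_zero_of_turning_point hV hμ (neg_ne_zero.2 hc.1.ne') rfl ?_ ?_
      · rw [uIcc_of_ge (by linarith [hc.1])]
        intro y hy hne
        have hyc : -c < y := lt_of_le_of_ne hy.1 hne.symm
        simpa using hrec (-y) ⟨by linarith [hy.2], by linarith⟩
      · rw [uIcc_of_ge (by linarith [hc.1])]
        exact fun y hy => hμpos y (hsub ⟨by linarith [hy.1, hc.2], by linarith [hy.2]⟩)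

/-! ### The chart in which the potential is `s ^ 2` -/

/-- The square root of `V`, taken with the sign of the argument. -/
noncomputable def signedRoot (V : ℝ → ℝ) (x : ℝ) : ℝ :=
  √(V (max x 0)) - √(V (min x 0))

/-- `2 ((q √μ)' + q (√μ)')` for `q = V / V' ^ 2`, a primitive of twice `monotonicityFunction`. -/
noncomputable def periodSlope (V μ : ℝ → ℝ) (x : ℝ) : ℝ :=
  2 * (deriv (chiconeQuotient V) x * √(μ x) + 2 * (chiconeQuotient V x * deriv (fun z => √(μ z)) x))

/-- `X` is the coordinate change on `(-√E, √E)` that turns the potential into `s ^ 2`. -/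
structure IsChart (V : ℝ → ℝ) (a b E : ℝ) (X : ℝ → ℝ) : Prop where
  strictMonoOn : StrictMonoOn X (Ioo (-√E) √E)
  mem : ∀ s ∈ Ioo (-√E) √E, X s ∈ Ioo a b
  potential : ∀ s ∈ Ioo (-√E) √E, V (X s) = s ^ 2
  hasDerivAt : ∀ s ∈ Ioo (-√E) √E, HasDerivAt X (2 * √(chiconeQuotient V (X s))) s

namespace IsWell

variable {V μ : ℝ → ℝ} {a b E : ℝ}

theorem strictMonoOn (W : IsWell V μ a b E) : StrictMonoOn V (Icc 0 b) := by
  refine strictMonoOn_of_deriv_pos (convex_Icc _ _) W.smooth.continuous.continuousOn fun x hx => ?_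
  rw [interior_Icc] at hx
  exact W.deriv_pos x ⟨hx.1, hx.2.le⟩

theorem strictAntiOn (W : IsWell V μ a b E) : StrictAntiOn V (Icc a 0) := by
  refine strictAntiOn_of_deriv_neg (convex_Icc _ _) W.smooth.continuous.continuousOn fun x hx => ?_
  rw [interior_Icc] at hx
  exact W.deriv_neg x ⟨hx.1.le, hx.2⟩

theorem deriv_ne_zero (W : IsWell V μ a b E) {x : ℝ} (hx : x ∈ Icc a b) (h0 : x ≠ 0) :
    deriv V x ≠ 0 := by
  rcases h0.lt_or_gt with h | h
  · exact (W.deriv_neg x ⟨hx.1, h⟩).ne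
  · exact (W.deriv_pos x ⟨h, hx.2⟩).ne'

theorem pos (W : IsWell V μ a b E) {x : ℝ} (hx : x ∈ Icc a b) (h0 : x ≠ 0) : 0 < V x := by
  rw [← W.zero]
  rcases h0.lt_or_gt with h | h
  · exact W.strictAntiOn ⟨hx.1, h.le⟩ ⟨W.left.le, le_rfl⟩ h
  · exact W.strictMonoOn ⟨le_rfl, W.right.le⟩ ⟨h.le, hx.2⟩ h

theorem nonneg (W : IsWell V μ a b E) {x : ℝ} (hx : x ∈ Icc a b) : 0 ≤ V x := by
  rcases eq_or_ne x 0 with rfl | h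
  · exact W.zero.ge
  · exact (W.pos hx h).le

theorem chiconeQuotient_pos (W : IsWell V μ a b E) {x : ℝ} (hx : x ∈ Icc a b) :
    0 < chiconeQuotient V x := by
  rw [chiconeQuotient]
  split_ifs with h
  · have := W.deriv2_pos
    positivity
  · have := W.pos hx h
    have := W.deriv_ne_zero hx h
    positivity

theorem signedRoot_of_nonneg (W : IsWell V μ a b E) {x : ℝ} (hx : 0 ≤ x) :
    signedRoot V x = √(V x) := by
  simp [signedRoot, hx, W.zero]

theorem signedRoot_of_nonpos (W : IsWell V μ a b E) {x : ℝ} (hx : x ≤ 0) :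
    signedRoot V x = -√(V x) := by
  simp [signedRoot, hx, W.zero]

theorem signedRoot_sq (W : IsWell V μ a b E) {x : ℝ} (hx : x ∈ Icc a b) :
    signedRoot V x ^ 2 = V x := by
  rcases le_total 0 x with h | h
  · rw [W.signedRoot_of_nonneg h, Real.sq_sqrt (W.nonneg hx)]
  · rw [W.signedRoot_of_nonpos h, neg_sq, Real.sq_sqrt (W.nonneg hx)]

theorem continuous_signedRoot (W : IsWell V μ a b E) : Continuous (signedRoot V) := by
  have := W.smooth.continuous
  unfold signedRoot
  fun_prop

theorem strictMonoOn_signedRoot (W : IsWell V μ a b E) :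
    StrictMonoOn (signedRoot V) (Icc a b) := by
  have hneg : StrictMonoOn (signedRoot V) (Icc a 0) := by
    intro x hx y hy hxy
    rw [W.signedRoot_of_nonpos hx.2, W.signedRoot_of_nonpos hy.2, neg_lt_neg_iff]
    exact Real.sqrt_lt_sqrt (W.nonneg ⟨hy.1, hy.2.trans W.right.le⟩) (W.strictAntiOn hx hy hxy)
  have hpos : StrictMonoOn (signedRoot V) (Icc 0 b) := by
    intro x hx y hy hxy
    rw [W.signedRoot_of_nonneg hx.1, W.signedRoot_of_nonneg hy.1]
    exact Real.sqrt_lt_sqrt (W.nonneg ⟨W.left.le.trans hx.1, hx.2⟩) (W.strictMonoOn hx hy hxy)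
  have := hneg.union hpos (isGreatest_Icc W.left.le) (isLeast_Icc W.right.le)
  rwa [Icc_union_Icc_eq_Icc W.left.le W.right.le] at this

/-- Here `(√V)' = V' / (2 √V)` has absolute value `1 / (2 √q)`, and the sign of the root matches
that of `V'`. -/
theorem hasDerivAt_signedRoot (W : IsWell V μ a b E) {x : ℝ} (hx : x ∈ Icc a b) (h0 : x ≠ 0) :
    HasDerivAt (signedRoot V) (2 * √(chiconeQuotient V x))⁻¹ x := by
  have hVx := W.pos hx h0
  have hroot : HasDerivAt (fun y => √(V y)) (deriv V x / (2 * √(V x))) x :=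
    (W.smooth.differentiable (by simp) x).hasDerivAt.sqrt hVx.ne'
  have hq : √(chiconeQuotient V x) = √(V x) / |deriv V x| := by
    rw [chiconeQuotient, if_neg h0, Real.sqrt_div hVx.le, Real.sqrt_sq_eq_abs]
  have hsqrt : 0 < √(V x) := Real.sqrt_pos.2 hVx
  rw [hq]
  rcases h0.lt_or_gt with h | h
  · have hd := W.deriv_neg x ⟨hx.1, h⟩
    refine (hroot.neg.congr_of_eventuallyEq ?_).congr_deriv ?_
    · filter_upwards [Iio_mem_nhds h] with y hy using W.signedRoot_of_nonpos (le_of_lt hy)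
    · rw [abs_of_neg hd]
      field_simp
  · have hd := W.deriv_pos x ⟨h, hx.2⟩
    refine (hroot.congr_of_eventuallyEq ?_).congr_deriv ?_
    · filter_upwards [Ioi_mem_nhds h] with y hy using W.signedRoot_of_nonneg (le_of_lt hy)
    · rw [abs_of_pos hd]
      field_simp

theorem differentiableAt_chiconeQuotient (W : IsWell V μ a b E) {x : ℝ} (hx : x ∈ Icc a b) :
    DifferentiableAt ℝ (chiconeQuotient V) x := by
  rcases eq_or_ne x 0 with rfl | h
  · exact (differentiableAt_chiconeQuotient_zero W.smooth W.zero W.deriv_zero W.deriv2_pos).1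
  · exact (hasDerivAt_chiconeQuotient W.smooth h (W.deriv_ne_zero hx h)).differentiableAt

/-- The inverse of `signedRoot` turns the potential into `s ^ 2`. -/
theorem exists_chart (W : IsWell V μ a b E) :
    ∃ X : ℝ → ℝ, IsChart V a b E X := by
  have ha : signedRoot V a = -√E := by rw [W.signedRoot_of_nonpos W.left.le, W.left_eq]
  have hb : signedRoot V b = √E := by rw [W.signedRoot_of_nonneg W.right.le, W.right_eq]
  have hab : a ≤ b := W.left.le.trans W.right.le
  have hmono := W.strictMonoOn_signedRoot
  have hex : ∀ s, ∃ x, s ∈ Ioo (-√E) √E → x ∈ Ioo a b ∧ signedRoot V x = s := by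
    intro s
    by_cases hs : s ∈ Ioo (-√E) √E
    · obtain ⟨x, hx, hxs⟩ := intermediate_value_Ioo hab W.continuous_signedRoot.continuousOn
        (by rwa [ha, hb] : s ∈ Ioo (signedRoot V a) (signedRoot V b))
      exact ⟨x, fun _ => ⟨hx, hxs⟩⟩
    · exact ⟨0, fun h => absurd h hs⟩
  choose X hX using hex
  have hIcc : ∀ s ∈ Ioo (-√E) √E, X s ∈ Icc a b := fun s hs => Ioo_subset_Icc_self (hX s hs).1
  have hXmono : StrictMonoOn X (Ioo (-√E) √E) := by
    intro s hs t ht hst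
    rw [← hmono.lt_iff_lt (hIcc s hs) (hIcc t ht), (hX s hs).2, (hX t ht).2]
    exact hst
  have hXinv : ∀ x ∈ Ioo a b, signedRoot V x ∈ Ioo (-√E) √E ∧ X (signedRoot V x) = x := by
    intro x hx
    have hmem : signedRoot V x ∈ Ioo (-√E) √E := by
      rw [← ha, ← hb]
      exact ⟨hmono ⟨le_rfl, hab⟩ ⟨hx.1.le, hx.2.le⟩ hx.1,
        hmono ⟨hx.1.le, hx.2.le⟩ ⟨hab, le_rfl⟩ hx.2⟩
    exact ⟨hmem, hmono.injOn (hIcc _ hmem) ⟨hx.1.le, hx.2.le⟩ (hX _ hmem).2⟩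
  have hcont : ∀ s ∈ Ioo (-√E) √E, ContinuousAt X s := by
    intro s hs
    refine hXmono.continuousAt_of_image_mem_nhds (isOpen_Ioo.mem_nhds hs) ?_
    refine mem_of_superset (isOpen_Ioo.mem_nhds (hX s hs).1) fun x hx => ?_
    exact ⟨_, (hXinv x hx).1, (hXinv x hx).2⟩
  have hV : ∀ s ∈ Ioo (-√E) √E, V (X s) = s ^ 2 := fun s hs => by
    rw [← W.signedRoot_sq (hIcc s hs), (hX s hs).2]
  have hne : ∀ s ∈ Ioo (-√E) √E, s ≠ 0 → HasDerivAt X (2 * √(chiconeQuotient V (X s))) s := by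
    intro s hs h0
    have hXs : X s ≠ 0 := by
      intro h
      have := hV s hs
      rw [h, W.zero] at this
      exact h0 (pow_eq_zero_iff two_ne_zero |>.1 this.symm)
    have hq := Real.sqrt_pos.2 (W.chiconeQuotient_pos (hIcc s hs))
    have := HasDerivAt.of_local_left_inverse (hcont s hs)
      (W.hasDerivAt_signedRoot (hIcc s hs) hXs) (by positivity)
      (by filter_upwards [isOpen_Ioo.mem_nhds hs] with y hy using (hX y hy).2)
    rwa [inv_inv] at this
  refine ⟨X, hXmono, fun s hs => (hX s hs).1, hV, fun s hs => ?_⟩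
  -- The derivative of `signedRoot` is only available off `0`; at `s = 0` the derivative of the
  -- chart is recovered as the limit of its nearby derivatives.
  rcases eq_or_ne s 0 with rfl | h0
  · refine hasDerivAt_of_tendsto_deriv_nhdsNE (g := fun s => 2 * √(chiconeQuotient V (X s)))
      ?_ (hcont 0 hs) ?_
    · filter_upwards [self_mem_nhdsWithin,
        mem_nhdsWithin_of_mem_nhds (isOpen_Ioo.mem_nhds hs)] with s h1 h2 using hne s h2 h1
    · have h1 : ContinuousAt (fun s => chiconeQuotient V (X s)) 0 :=
        ContinuousAt.comp (W.differentiableAt_chiconeQuotient (hIcc 0 hs)).continuousAt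
          (hcont 0 hs)
      have h2 : ContinuousAt (fun s => 2 * √(chiconeQuotient V (X s))) 0 := by fun_prop
      exact h2.tendsto.mono_left nhdsWithin_le_nhds
  · exact hne s hs h0

theorem contDiffAt_sqrt_mass (W : IsWell V μ a b E) {x : ℝ} (hx : x ∈ Icc a b) :
    ContDiffAt ℝ 2 (fun z => √(μ z)) x :=
  W.mass.contDiffAt.sqrt (W.mass_pos x hx).ne'

theorem hasDerivAt_sqrt_mass (W : IsWell V μ a b E) {x : ℝ} (hx : x ∈ Icc a b) :
    HasDerivAt (fun z => √(μ z)) (deriv μ x / (2 * √(μ x))) x :=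
  ((W.mass.differentiable two_ne_zero x).hasDerivAt).sqrt (W.mass_pos x hx).ne'

theorem hasDerivAt_periodSlope (W : IsWell V μ a b E) {x : ℝ} (hx : x ∈ Ioo a b) (h0 : x ≠ 0) :
    HasDerivAt (periodSlope V μ) (2 * monotonicityFunction V μ x) x := by
  have hxI := Ioo_subset_Icc_self hx
  have hq := contDiffAt_chiconeQuotient W.smooth h0 (W.deriv_ne_zero hxI h0)
  have hm := W.contDiffAt_sqrt_mass hxI
  have h1 := (differentiableAt_deriv_of_contDiffAt_two (hq.mul hm)).hasDerivAt
  have h2 := ((hq.differentiableAt two_ne_zero).mul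
    (differentiableAt_deriv_of_contDiffAt_two hm)).hasDerivAt
  refine ((h1.add h2).const_mul 2).congr_of_eventuallyEq ?_
  filter_upwards [isOpen_Ioo.mem_nhds hx] with y hy
  have hyI := Ioo_subset_Icc_self hy
  have := ((W.differentiableAt_chiconeQuotient hyI).hasDerivAt.fun_mul
    ((W.contDiffAt_sqrt_mass hyI).differentiableAt two_ne_zero).hasDerivAt).deriv
  simp only [Pi.add_apply, Pi.mul_apply, this, periodSlope]
  ring

theorem continuousOn_periodSlope (W : IsWell V μ a b E) :
    ContinuousOn (periodSlope V μ) (Ioo a b) := by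
  intro x hx
  refine ContinuousAt.continuousWithinAt ?_
  rcases eq_or_ne x 0 with rfl | h0
  · have hxI := Ioo_subset_Icc_self hx
    have hq := differentiableAt_chiconeQuotient_zero W.smooth W.zero W.deriv_zero W.deriv2_pos
    have hm := W.contDiffAt_sqrt_mass hxI
    have h1 := hq.1.continuousAt
    have h2 := hq.2
    have h3 := hm.continuousAt
    have h4 := (differentiableAt_deriv_of_contDiffAt_two hm).continuousAt
    unfold periodSlope
    fun_prop
  · exact (W.hasDerivAt_periodSlope hx h0).continuousAt

/-- At `0` only `C^1` regularity of `q` is established, so the sign of the derivative is used on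
each side of `0` and continuity joins the two halves. -/
theorem monotoneOn_mul_periodSlope (W : IsWell V μ a b E) {σ : ℝ}
    (hN : ∀ x ∈ Icc a b, 0 ≤ σ * monotonicityFunction V μ x) :
    MonotoneOn (fun x => σ * periodSlope V μ x) (Ioo a b) := by
  have hd : ∀ x ∈ Ioo a b, x ≠ 0 → HasDerivAt (fun x => σ * periodSlope V μ x)
      (σ * (2 * monotonicityFunction V μ x)) x := fun x hx h0 =>
    (W.hasDerivAt_periodSlope hx h0).const_mul σ
  have hpos : ∀ x ∈ Ioo a b, x ≠ 0 → 0 ≤ deriv (fun x => σ * periodSlope V μ x) x := by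
    intro x hx h0
    rw [(hd x hx h0).deriv]
    linarith [hN x (Ioo_subset_Icc_self hx)]
  have hc : ContinuousOn (fun x => σ * periodSlope V μ x) (Ioo a b) :=
    continuousOn_const.mul W.continuousOn_periodSlope
  have hleft : MonotoneOn (fun x => σ * periodSlope V μ x) (Ioc a 0) := by
    refine monotoneOn_of_deriv_nonneg (convex_Ioc _ _)
      (hc.mono fun x hx => ⟨hx.1, hx.2.trans_lt W.right⟩) ?_ ?_
    · rw [interior_Ioc]
      exact fun x hx =>
        (hd x ⟨hx.1, hx.2.trans W.right⟩ hx.2.ne).differentiableAt.differentiableWithinAt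
    · rw [interior_Ioc]
      exact fun x hx => hpos x ⟨hx.1, hx.2.trans W.right⟩ hx.2.ne
  have hright : MonotoneOn (fun x => σ * periodSlope V μ x) (Ico 0 b) := by
    refine monotoneOn_of_deriv_nonneg (convex_Ico _ _)
      (hc.mono fun x hx => ⟨W.left.trans_le hx.1, hx.2⟩) ?_ ?_
    · rw [interior_Ico]
      exact fun x hx =>
        (hd x ⟨W.left.trans hx.1, hx.2⟩ hx.1.ne').differentiableAt.differentiableWithinAt
    · rw [interior_Ico]
      exact fun x hx => hpos x ⟨W.left.trans hx.1, hx.2⟩ hx.1.ne'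
  have := hleft.union_right hright (isGreatest_Ioc W.left) (isLeast_Ico W.right)
  rwa [Ioc_union_Ico_eq_Ioo W.left W.right] at this

end IsWell

/-! ### Convexity of the time density -/

/-- The time density `√μ(X) X'` in the coordinate `s`, where `V (X s) = s ^ 2`. -/
noncomputable def timeDensity (V μ X : ℝ → ℝ) (s : ℝ) : ℝ :=
  2 * (√(chiconeQuotient V (X s)) * √(μ (X s)))

namespace IsWell

variable {V μ X : ℝ → ℝ} {a b E : ℝ}

theorem timeDensity_pos (W : IsWell V μ a b E) (hX : IsChart V a b E X) {s : ℝ}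
    (hs : s ∈ Ioo (-√E) √E) : 0 < timeDensity V μ X s := by
  have h := Ioo_subset_Icc_self (hX.mem s hs)
  have := Real.sqrt_pos.2 (W.chiconeQuotient_pos h)
  have := Real.sqrt_pos.2 (W.mass_pos _ h)
  unfold timeDensity
  positivity

/-- The factor `X' = 2 √q` cancels the `√q` in the denominator of `(√q)'`, so the slope depends on
`q` without roots. -/
theorem hasDerivAt_timeDensity (W : IsWell V μ a b E) (hX : IsChart V a b E X) {s : ℝ}
    (hs : s ∈ Ioo (-√E) √E) : HasDerivAt (timeDensity V μ X) (periodSlope V μ (X s)) s := by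
  have h := Ioo_subset_Icc_self (hX.mem s hs)
  have hq := (W.differentiableAt_chiconeQuotient h).hasDerivAt.sqrt (W.chiconeQuotient_pos h).ne'
  have hm := ((W.contDiffAt_sqrt_mass h).differentiableAt two_ne_zero).hasDerivAt
  refine ((((hq.mul hm).const_mul 2).comp s (hX.hasDerivAt s hs))).congr_deriv ?_
  have h1 := W.chiconeQuotient_pos h
  have h2 := Real.sqrt_pos.2 h1
  have h3 := Real.sq_sqrt h1.le
  rw [periodSlope]
  field_simp
  rw [h3]
  ring

theorem convexOn_mul_timeDensity (W : IsWell V μ a b E) (hX : IsChart V a b E X) {σ : ℝ}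
    (hN : ∀ x ∈ Icc a b, 0 ≤ σ * monotonicityFunction V μ x) :
    ConvexOn ℝ (Ioo (-√E) √E) fun s => σ * timeDensity V μ X s := by
  have hd : ∀ s ∈ Ioo (-√E) √E, HasDerivAt (fun s => σ * timeDensity V μ X s)
      (σ * periodSlope V μ (X s)) s := fun s hs => (W.hasDerivAt_timeDensity hX hs).const_mul σ
  refine MonotoneOn.convexOn_of_deriv (convex_Ioo _ _)
    (fun s hs => (hd s hs).continuousAt.continuousWithinAt) ?_ ?_
  · rw [interior_Ioo]
    exact fun s hs => (hd s hs).differentiableAt.differentiableWithinAt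
  · rw [interior_Ioo]
    intro s hs t ht hst
    rw [(hd s hs).deriv, (hd t ht).deriv]
    exact W.monotoneOn_mul_periodSlope hN (hX.mem s hs) (hX.mem t ht)
      (hX.strictMonoOn.monotoneOn hs ht hst)

end IsWell

/-! ### Circular means of convex functions -/

theorem mul_sin_mem_Ioo {r R : ℝ} (hr : r ∈ Ico 0 R) (θ : ℝ) : r * Real.sin θ ∈ Ioo (-R) R := by
  rw [mem_Ioo, ← abs_lt, abs_mul, abs_of_nonneg hr.1]
  exact (mul_le_of_le_one_right hr.1 (Real.abs_sin_le_one θ)).trans_lt hr.2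

theorem ContinuousOn.continuous_comp_mul_sin {φ : ℝ → ℝ} {r R : ℝ}
    (hφ : ContinuousOn φ (Ioo (-R) R)) (hr : r ∈ Ico 0 R) :
    Continuous fun θ => φ (r * Real.sin θ) :=
  hφ.comp_continuous (by fun_prop) (mul_sin_mem_Ioo hr)

/-- Both `k v` and `-k v` are convex combinations of `v` and `-v`, with weights `(1 ± k) / 2`
interchanged; adding the two inequalities removes the weights. -/
theorem ConvexOn.add_neg_le_add_neg {φ : ℝ → ℝ} {S : Set ℝ} (hφ : ConvexOn ℝ S φ) {v k : ℝ}
    (hv : v ∈ S) (hv' : -v ∈ S) (hk : k ∈ Icc (0 : ℝ) 1) :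
    φ (k * v) + φ (-(k * v)) ≤ φ v + φ (-v) := by
  have h1 := hφ.2 hv hv' (show 0 ≤ (1 + k) / 2 by linarith [hk.1])
    (show 0 ≤ (1 - k) / 2 by linarith [hk.2]) (by ring)
  have h2 := hφ.2 hv hv' (show 0 ≤ (1 - k) / 2 by linarith [hk.2])
    (show 0 ≤ (1 + k) / 2 by linarith [hk.1]) (by ring)
  simp only [smul_eq_mul] at h1 h2
  rw [show (1 + k) / 2 * v + (1 - k) / 2 * -v = k * v by ring] at h1
  rw [show (1 - k) / 2 * v + (1 + k) / 2 * -v = -(k * v) by ring] at h2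
  linarith

/-- Circular means of a convex function increase with the radius. -/
theorem ConvexOn.monotoneOn_integral_mul_sin {φ : ℝ → ℝ} {R : ℝ}
    (hφ : ConvexOn ℝ (Ioo (-R) R) φ) (hc : ContinuousOn φ (Ioo (-R) R)) :
    MonotoneOn (fun r => ∫ θ in (0 : ℝ)..2 * Real.pi, φ (r * Real.sin θ)) (Ioo 0 R) := by
  -- Shifting `θ` by `π` changes the sign of the sine, so `φ` may be replaced by its even part, for
  -- which the integrands compare pointwise.
  have hsym : ∀ r : ℝ, ∫ θ in (0 : ℝ)..2 * Real.pi, φ (-(r * Real.sin θ)) =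
      ∫ θ in (0 : ℝ)..2 * Real.pi, φ (r * Real.sin θ) := by
    intro r
    have hper : Function.Periodic (fun θ => φ (r * Real.sin θ)) (2 * Real.pi) := fun θ => by
      simp [Real.sin_add_two_pi]
    have h := intervalIntegral.integral_comp_add_right (a := 0) (b := 2 * Real.pi)
      (fun θ => φ (r * Real.sin θ)) Real.pi
    simp only [Real.sin_add_pi, mul_neg] at h
    rw [h, zero_add, add_comm (2 * Real.pi), hper.intervalIntegral_add_eq Real.pi 0, zero_add]
  have htwo : ∀ r ∈ Ioo 0 R,
      ∫ θ in (0 : ℝ)..2 * Real.pi, (φ (r * Real.sin θ) + φ (-(r * Real.sin θ))) =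
      2 * ∫ θ in (0 : ℝ)..2 * Real.pi, φ (r * Real.sin θ) := by
    intro r hr
    have hc1 := hc.continuous_comp_mul_sin ⟨hr.1.le, hr.2⟩
    have hc2 : Continuous fun θ => φ (-(r * Real.sin θ)) :=
      hc.comp_continuous (by fun_prop) fun θ => by
        have := mul_sin_mem_Ioo ⟨hr.1.le, hr.2⟩ θ
        exact ⟨by linarith [this.2], by linarith [this.1]⟩
    rw [intervalIntegral.integral_add (hc1.intervalIntegrable _ _) (hc2.intervalIntegrable _ _),
      hsym, ← two_mul]
  intro r hr s hs hrs
  have hcont : ∀ r ∈ Ioo 0 R, Continuous fun θ =>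
      φ (r * Real.sin θ) + φ (-(r * Real.sin θ)) := by
    intro r hr
    refine (hc.continuous_comp_mul_sin ⟨hr.1.le, hr.2⟩).add
      (hc.comp_continuous (by fun_prop) fun θ => ?_)
    have := mul_sin_mem_Ioo ⟨hr.1.le, hr.2⟩ θ
    exact ⟨by linarith [this.2], by linarith [this.1]⟩
  have key := intervalIntegral.integral_mono_on (μ := MeasureTheory.volume)
    (f := fun θ => φ (r * Real.sin θ) + φ (-(r * Real.sin θ)))
    (g := fun θ => φ (s * Real.sin θ) + φ (-(s * Real.sin θ)))
    (by positivity : 0 ≤ 2 * Real.pi) ((hcont r hr).intervalIntegrable _ _)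
    ((hcont s hs).intervalIntegrable _ _) fun θ _ => by
      have hmem := mul_sin_mem_Ioo ⟨hs.1.le, hs.2⟩ θ
      have := hφ.add_neg_le_add_neg (k := r / s) hmem
        ⟨by linarith [hmem.2], by linarith [hmem.1]⟩
        ⟨div_nonneg hr.1.le hs.1.le, (div_le_one hs.1).2 hrs⟩
      rwa [← mul_assoc, div_mul_cancel₀ _ hs.1.ne'] at this
  rw [htwo r hr, htwo s hs] at key
  simpa using key

/-! ### The explicit orbit and the period formula -/

/-- The phase `θ` with `θ' = 1 / w(θ)` for a positive `2π`-periodic density `w`. -/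
theorem exists_phase {w : ℝ → ℝ} (hw : Continuous w) (hpos : ∀ θ, 0 < w θ)
    (hper : Function.Periodic w (2 * Real.pi)) :
    ∃ θ : ℝ → ℝ, θ 0 = 0 ∧ StrictMono θ ∧ Function.Surjective θ ∧
      (∀ t, HasDerivAt θ (w (θ t))⁻¹ t) ∧
      ∀ t, θ (t + ∫ φ in (0 : ℝ)..2 * Real.pi, w φ) = θ t + 2 * Real.pi := by
  -- `τ θ` is the time at which phase `θ` is reached; the required function is its inverse.
  set τ : ℝ → ℝ := fun θ => ∫ φ in (0 : ℝ)..θ, w φ with hτ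
  have hτd : ∀ θ, HasDerivAt τ (w θ) θ := fun θ => hw.integral_hasStrictDerivAt 0 θ |>.hasDerivAt
  have hτmono : StrictMono τ := strictMono_of_deriv_pos fun θ => by
    rw [(hτd θ).deriv]
    exact hpos θ
  have hτc : Continuous τ := continuous_iff_continuousAt.2 fun θ => (hτd θ).continuousAt
  -- Periodicity gives a positive lower bound for `w`, so `τ` grows at least linearly and is onto.
  obtain ⟨m, hm0, hm⟩ : ∃ m > 0, ∀ θ, m ≤ w θ := by
    obtain ⟨z, -, hz⟩ := isCompact_Icc.exists_isMinOn (nonempty_Icc.2 Real.two_pi_pos.le)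
      hw.continuousOn
    refine ⟨w z, hpos z, fun θ => ?_⟩
    obtain ⟨y, hy, hy'⟩ := hper.exists_mem_Ico₀ Real.two_pi_pos θ
    rw [hy']
    exact hz ⟨hy.1, hy.2.le⟩
  have hτ0 : τ 0 = 0 := intervalIntegral.integral_same
  have hlin : Monotone fun θ => τ θ - m * θ := by
    have hd : ∀ θ, HasDerivAt (fun θ => τ θ - m * θ) (w θ - m) θ := fun θ => by
      simpa using (hτd θ).fun_sub ((hasDerivAt_id θ).const_mul m)
    refine monotone_of_deriv_nonneg (fun θ => (hd θ).differentiableAt) fun θ => ?_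
    rw [(hd θ).deriv]
    linarith [hm θ]
  have hτs : Function.Surjective τ := by
    refine hτc.surjective ?_ ?_
    · refine tendsto_atTop_mono' _ ?_ (tendsto_id.const_mul_atTop hm0)
      filter_upwards [eventually_ge_atTop 0] with θ hθ
      have := hlin hθ
      simp only [hτ0] at this
      simp only [id]
      linarith
    · refine tendsto_atBot_mono' _ ?_ (tendsto_id.const_mul_atBot hm0)
      filter_upwards [eventually_le_atBot 0] with θ hθ
      have := hlin hθ
      simp only [hτ0] at this
      simp only [id]
      linarith
  set e := StrictMono.orderIsoOfSurjective τ hτmono hτs with he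
  have hright : ∀ t, τ (e.symm t) = t := fun t => e.apply_symm_apply t
  refine ⟨e.symm, ?_, e.symm.strictMono, e.symm.surjective, fun t => ?_, fun t => ?_⟩
  · apply hτmono.injective
    rw [hright, hτ0]
  · exact HasDerivAt.of_local_left_inverse e.symm.continuous.continuousAt (hτd _) (hpos _).ne'
      (Eventually.of_forall hright)
  · apply hτmono.injective
    rw [hright]
    have h1 := hper.intervalIntegral_add_eq (e.symm t) 0
    have h2 := intervalIntegral.integral_add_adjacent_intervals (hw.intervalIntegrable 0 (e.symm t))
      (hw.intervalIntegrable (e.symm t) (e.symm t + 2 * Real.pi))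
      (μ := MeasureTheory.volume)
    rw [h1, zero_add] at h2
    have h3 := hright t
    simp only [hτ] at h3 ⊢
    rw [← h2, h3]

/-- The point of phase `θ` on the energy level `c ^ 2`. -/
noncomputable def orbitPoint (μ X : ℝ → ℝ) (c θ : ℝ) : ℝ × ℝ :=
  (X (c * Real.sin θ), √2 * c * (√(μ (X (c * Real.sin θ))) * Real.cos θ))

namespace IsWell

variable {V μ X : ℝ → ℝ} {a b E c : ℝ}

theorem chart_zero (W : IsWell V μ a b E) (hX : IsChart V a b E X) (hE : 0 < E) : X 0 = 0 := by
  have h0 : (0 : ℝ) ∈ Ioo (-√E) √E := by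
    have := Real.sqrt_pos.2 hE
    exact ⟨by linarith, this⟩
  by_contra h
  have := W.pos (Ioo_subset_Icc_self (hX.mem 0 h0)) h
  rw [hX.potential 0 h0] at this
  simp at this

/-- Differentiating `V (X s) = s ^ 2` expresses `V'` through `√q` without distinguishing the sides
of `0`; this settles the equation for `p`. -/
theorem deriv_mul_chart (hV : Differentiable ℝ V) (hX : IsChart V a b E X) {s : ℝ}
    (hs : s ∈ Ioo (-√E) √E) : deriv V (X s) * √(chiconeQuotient V (X s)) = s := by
  have h1 : HasDerivAt (fun s => V (X s)) _ s :=
    (hV (X s)).hasDerivAt.comp s (hX.hasDerivAt s hs)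
  have h2 : HasDerivAt (fun s => V (X s)) (2 * s) s := by
    refine HasDerivAt.congr_of_eventuallyEq (f := fun s => s ^ 2) ?_ ?_
    · simpa using hasDerivAt_pow 2 s
    · filter_upwards [isOpen_Ioo.mem_nhds hs] with y hy using hX.potential y hy
  have := h1.unique h2
  linarith

/-- The equation for `x` reads `X' c cos θ · θ' = √2 c cos θ / √μ`, which is where the phase speed
comes from. -/
theorem hasDerivAt_orbitPoint (W : IsWell V μ a b E) (hX : IsChart V a b E X)
    (hc : c ∈ Ioo 0 √E) {θ : ℝ → ℝ} {t : ℝ}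
    (hθ : HasDerivAt θ (timeDensity V μ X (c * Real.sin (θ t)) / √2)⁻¹ t) :
    HasDerivAt (fun t => orbitPoint μ X c (θ t))
      (hamiltonianField V μ (orbitPoint μ X c (θ t))) t := by
  have hs := mul_sin_mem_Ioo ⟨hc.1.le, hc.2⟩ (θ t)
  have hI := Ioo_subset_Icc_self (hX.mem _ hs)
  have hμ := W.mass_pos _ hI
  have hrμ := Real.sqrt_pos.2 hμ
  have hq := Real.sqrt_pos.2 (W.chiconeQuotient_pos hI)
  have hVs := deriv_mul_chart (W.smooth.differentiable (by simp)) hX hs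
  have hsq := Real.sq_sqrt hμ.le
  have h2 := Real.sq_sqrt (zero_le_two (α := ℝ))
  have h2' : (0 : ℝ) < √2 := by positivity
  have hx : HasDerivAt (fun t => X (c * Real.sin (θ t))) _ t :=
    (hX.hasDerivAt _ hs).comp t (hθ.sin.const_mul c)
  have hx' := hx.congr_deriv (g' := √2 * c * Real.cos (θ t) / √(μ (X (c * Real.sin (θ t))))) (by
    rw [timeDensity]
    field_simp)
  have hm : HasDerivAt (fun t => √(μ (X (c * Real.sin (θ t))))) _ t :=
    HasDerivAt.comp (h₂ := fun z => √(μ z)) t (W.hasDerivAt_sqrt_mass hI) hx'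
  have hp := (hm.fun_mul hθ.cos).const_mul (√2 * c)
  refine (hx'.prodMk hp).congr_deriv ?_
  rw [timeDensity]
  simp only [hamiltonianField, orbitPoint]
  generalize X (c * Real.sin (θ t)) = x at *
  generalize √(chiconeQuotient V x) = q at *
  have hVx : deriv V x = c * Real.sin (θ t) / q := by
    rw [← hVs]
    field_simp
  rw [hVx]
  generalize √(μ x) = m at *
  rw [← hsq]
  ext
  · simp only
    field_simp
  · simp only
    field_simp
    rw [h2]
    ring

/-- A closed orbit is a time translate of the orbit with the explicit phase. -/
theorem exists_translate (W : IsWell V μ a b E) (hX : IsChart V a b E X) (hc : c ∈ Ioo 0 √E)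
    {θ : ℝ → ℝ} (hsurj : Function.Surjective θ)
    (hθ : ∀ t, HasDerivAt θ (timeDensity V μ X (c * Real.sin (θ t)) / √2)⁻¹ t)
    {τ : ℝ} {γ : ℝ → ℝ × ℝ} (hγ : IsClosedOrbit V μ (c ^ 2) τ γ) :
    ∃ d, ∀ t, γ t = orbitPoint μ X c (θ (t + d)) := by
  have hE : 0 < E := Real.sqrt_pos.1 (hc.1.trans hc.2)
  have hX0 := W.chart_zero hX hE
  have hμ := W.mass_pos 0 ⟨W.left.le, W.right.le⟩
  obtain ⟨t₀, ht₀⟩ := hγ.exists_fst_eq_zero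
  have hen := hγ.energy t₀
  rw [hamiltonian, ht₀, W.zero, add_zero, div_eq_iff (by positivity)] at hen
  have hsq : (γ t₀).2 ^ 2 = (√2 * c * √(μ 0)) ^ 2 := by
    rw [hen, mul_pow, mul_pow, Real.sq_sqrt hμ.le, Real.sq_sqrt zero_le_two]
    ring
  -- Over `x = 0` the energy leaves only `p = ±√2 c √μ(0)`, that is, phase `0` or `π`.
  obtain ⟨φ, hφ⟩ : ∃ φ, orbitPoint μ X c φ = γ t₀ := by
    rcases sq_eq_sq_iff_eq_or_eq_neg.1 hsq with h | h
    · exact ⟨0, Prod.ext (by simp [orbitPoint, hX0, ht₀]) (by simp [orbitPoint, hX0, h])⟩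
    · exact ⟨Real.pi, Prod.ext (by simp [orbitPoint, hX0, ht₀]) (by simp [orbitPoint, hX0, h])⟩
  obtain ⟨u, rfl⟩ := hsurj φ
  refine ⟨u - t₀, fun t => ?_⟩
  have hsol : ∀ t, HasDerivAt (fun t => orbitPoint μ X c (θ (t + (u - t₀))))
      (hamiltonianField V μ (orbitPoint μ X c (θ (t + (u - t₀))))) t := fun t =>
    (W.hasDerivAt_orbitPoint hX hc (hθ _)).comp_add_const t (u - t₀)
  have := eq_of_hasDerivAt_hamiltonianField W.smooth W.mass hsol hγ.solution
    (fun t => (W.mass_pos _ (Ioo_subset_Icc_self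
      (hX.mem _ (mul_sin_mem_Ioo ⟨hc.1.le, hc.2⟩ _)))).ne') (t₀ := t₀) (by simpa using hφ)
  exact (congrFun this t).symm

theorem two_pi_le_of_orbitPoint_eq (W : IsWell V μ a b E) (hX : IsChart V a b E X)
    (hc : c ∈ Ioo 0 √E) {φ : ℝ} (hφ : 0 < φ) (h : orbitPoint μ X c φ = orbitPoint μ X c 0) :
    2 * Real.pi ≤ φ := by
  have h1 : X (c * Real.sin φ) = X (c * Real.sin 0) := congrArg Prod.fst h
  have h2 : √2 * c * (√(μ (X (c * Real.sin φ))) * Real.cos φ) =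
    √2 * c * (√(μ (X (c * Real.sin 0))) * Real.cos 0) := congrArg Prod.snd h
  have hμ := Real.sqrt_pos.2 (W.mass_pos _ (Ioo_subset_Icc_self
      (hX.mem _ (mul_sin_mem_Ioo ⟨hc.1.le, hc.2⟩ 0))))
  have hc0 := hc.1
  -- Equal positions have equal masses, so equal momenta give `cos φ = 1`.
  rw [h1, mul_right_inj' (by positivity), mul_right_inj' hμ.ne', Real.cos_zero] at h2
  obtain ⟨k, rfl⟩ := (Real.cos_eq_one_iff φ).1 h2
  have hk : (0 : ℝ) < k := pos_of_mul_pos_left hφ Real.two_pi_pos.le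
  have hk' : (1 : ℝ) ≤ k := by exact_mod_cast (Int.cast_pos.1 hk : 0 < k)
  exact le_mul_of_one_le_left Real.two_pi_pos.le hk'

theorem periodFunction_eq (W : IsWell V μ a b E) (hX : IsChart V a b E X) (hc : c ∈ Ioo 0 √E)
    (hex : ∃ τ γ, IsClosedOrbit V μ (c ^ 2) τ γ) :
    periodFunction V μ (c ^ 2) =
      (∫ φ in (0 : ℝ)..2 * Real.pi, timeDensity V μ X (c * Real.sin φ)) / √2 := by
  have hF : ContinuousOn (timeDensity V μ X) (Ioo (-√E) √E) := fun s hs =>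
    (W.hasDerivAt_timeDensity hX hs).continuousAt.continuousWithinAt
  have hpos : ∀ φ, 0 < timeDensity V μ X (c * Real.sin φ) / √2 := fun φ =>
    div_pos (W.timeDensity_pos hX (mul_sin_mem_Ioo ⟨hc.1.le, hc.2⟩ φ)) (by positivity)
  obtain ⟨θ, hθ0, hmono, hsurj, hθ, hper⟩ := exists_phase
    (w := fun φ => timeDensity V μ X (c * Real.sin φ) / √2)
    ((hF.continuous_comp_mul_sin ⟨hc.1.le, hc.2⟩).div_const _) hpos
    (fun φ => by simp [Real.sin_add_two_pi])
  rw [← intervalIntegral.integral_div]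
  set T := ∫ φ in (0 : ℝ)..2 * Real.pi, timeDensity V μ X (c * Real.sin φ) / √2
  have hT : 0 < T := by
    rw [← hmono.lt_iff_lt, hθ0]
    have := hper 0
    rw [zero_add, hθ0, zero_add] at this
    rw [this]
    exact Real.two_pi_pos
  refine IsLeast.csInf_eq ⟨?_, ?_⟩
  -- The given orbit already surrounds the origin; being a translate of the explicit one, it also
  -- has period `T`.
  · obtain ⟨τ, γ, hγ⟩ := hex
    obtain ⟨d, hd⟩ := W.exists_translate hX hc hsurj hθ hγ
    refine ⟨γ, hγ.solution, hγ.energy, hT, fun t => ?_, hγ.surrounds⟩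
    rw [hd, hd, add_right_comm, hper]
    simp [orbitPoint, Real.sin_add_two_pi, Real.cos_add_two_pi]
  · rintro τ ⟨γ, hγ⟩
    obtain ⟨d, hd⟩ := W.exists_translate hX hc hsurj hθ hγ
    -- At time `-d` the phase is `0`, so a period `τ` brings the phase `θ τ` back to the same point;
    -- hence `θ τ ≥ 2π = θ T`.
    have h := hγ.periodic (-d)
    rw [hd, hd, add_right_comm, neg_add_cancel, zero_add, hθ0] at h
    have h2 := W.two_pi_le_of_orbitPoint_eq hX hc (hθ0 ▸ hmono hγ.period_pos) h
    rw [← hmono.le_iff_le]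
    have := hper 0
    rw [zero_add, hθ0, zero_add] at this
    rwa [this]

/-! ### Monotonicity of the period -/

theorem monotoneOn_mul_periodFunction (W : IsWell V μ a b E) {σ : ℝ}
    (hN : ∀ x ∈ Icc a b, 0 ≤ σ * monotonicityFunction V μ x)
    (hex : ∀ e ∈ Ioo 0 E, ∃ τ γ, IsClosedOrbit V μ e τ γ) :
    MonotoneOn (fun e => σ * periodFunction V μ e) (Ioo 0 E) := by
  obtain ⟨X, hX⟩ := W.exists_chart
  have hconv := W.convexOn_mul_timeDensity hX hN
  have hmono := hconv.monotoneOn_integral_mul_sin fun s hs =>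
    ((W.hasDerivAt_timeDensity hX hs).const_mul σ).continuousAt.continuousWithinAt
  have hmem : ∀ e ∈ Ioo 0 E, √e ∈ Ioo 0 √E := fun e he =>
    ⟨Real.sqrt_pos.2 he.1, Real.sqrt_lt_sqrt he.1.le he.2⟩
  have hT : ∀ e ∈ Ioo 0 E, σ * periodFunction V μ e =
      (∫ φ in (0 : ℝ)..2 * Real.pi, σ * timeDensity V μ X (√e * Real.sin φ)) / √2 := by
    intro e he
    have hsq := Real.sq_sqrt he.1.le
    have := W.periodFunction_eq hX (hmem e he) (by rw [hsq]; exact hex e he)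
    rw [hsq] at this
    rw [this, intervalIntegral.integral_const_mul, mul_div_assoc]
  intro e he f hf hef
  simp only [hT e he, hT f hf]
  exact div_le_div_of_nonneg_right (hmono (hmem e he) (hmem f hf) (Real.sqrt_le_sqrt hef))
    (by positivity)

end IsWell

theorem theorem1 (V μ : ℝ → ℝ) (hV : ContDiff ℝ ∞ V) (hμ : ContDiff ℝ 2 μ)
    (hV0 : V 0 = 0) (hV1 : deriv V 0 = 0) (hV2 : 0 < deriv (deriv V) 0)
    (Estar : ℝ) (hcentre : HasCentre V μ Estar)
    (E : ℝ) (hE : E ∈ Ioo 0 Estar) (hμpos : ∀ x ∈ potentialWell V E, 0 < μ x) :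
    ((∀ x ∈ potentialWell V E, 0 ≤ monotonicityFunction V μ x) →
        MonotoneOn (periodFunction V μ) (Ioo 0 E)) ∧
      ((∀ x ∈ potentialWell V E, monotonicityFunction V μ x ≤ 0) →
        AntitoneOn (periodFunction V μ) (Ioo 0 E)) := by
  obtain ⟨a, b, hsub, W⟩ := exists_isWell hV hμ hV0 hV1 hV2 hcentre hE hμpos
  have hex : ∀ e ∈ Ioo 0 E, ∃ τ γ, IsClosedOrbit V μ e τ γ := fun e he =>
    hcentre e ⟨he.1, he.2.trans hE.2⟩
  constructor
  · intro hN
    have := W.monotoneOn_mul_periodFunction (σ := 1)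
      (fun x hx => by simpa using hN x (hsub hx)) hex
    simpa using this
  · intro hN e he f hf hef
    have := W.monotoneOn_mul_periodFunction (σ := -1)
      (fun x hx => by simpa using hN x (hsub hx)) hex he hf hef
    simpa using this
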